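/- **Definitions.** A Steiner tree instance $I=(G,R,c)$ consists of a finite connected simple graph $G=(V,E)$, a nonempty set $R\subseteq V$ of required vertices and edge costs $c:E\to\mathbb R_{\ge 0}$. Replace every edge $\{v,w\}$ by the two arcs $(v,w),(w,v)$; for a vector $x$ on the arcs and $U\subseteq V$ let $x(\delta^-(U))$ and $x(\delta^+(U))$ be the total value of the arcs entering, respectively leaving, $U$. For a root $r\in R$: * $\operatorname{opt}_{\mathcal{BCR}}(I)$ is the minimum of $\sum_{\{v,w\}\in E}c(\{v,w\})\,(x(v,w)+x(w,v))$ over all $x\ge 0$ with $x(\delta^-(U))\ge 1$ for every $U\subseteq V\setminus\{r\}$ with $U\cap R\neq\emptyset$ (the bidirected cut relaxation); * $\operatorname{opt}_{\mathcal{BCR}^+}(I)$ is the minimum of the same objective under the additional constraints $x(\delta^-(v))\le x(\delta^+(v))$ for every Steiner vertex $v\in V\setminus R$; * $\operatorname{gap}_{\mathcal{BCR},\mathcal{BCR}^+}(I)=\operatorname{opt}_{\mathcal{BCR}^+}(I)/\operatorname{opt}_{\mathcal{BCR}}(I)$ (with the convention $0/0=0$). Let $\operatorname{gap}_{\mathcal{BCR}_{\le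 k},\mathcal{BCR}^+_{\le k}}$ be the supremum of $\operatorname{gap}_{\mathcal{BCR},\mathcal{BCR}^+}(I)$ over all Steiner tree instances $I$ with $|R|\le k$ and all roots $r \in R$. For $d,s\in\mathbb N$ let $\triangle^{\mathbb Z}_{d,s}=\{v\in\mathbb Z_{\ge 0}^{d+1}:\sum_i v_i=s\}$. The simplex instance $\operatorname{SI}_{d,s}$ has vertex set $\{v\in\triangle^{\mathbb Z}_{d,s}\cup\triangle^{\mathbb Z}_{d,s+1}:\max_i v_i\le s\}$, an edge between $v$ and $w$ exactly if $\|v-w\|_1=1$, required vertices $s\cdot e_1,\dots,s\cdot e_{d+1}$ (where $e_i$ are the unit vectors), and edge costs $c(\{v,w\})=\|v-w\|_1$. **Theorem.** Let $d,s\in\mathbb N$ with $d\ge 1$, $s\ge 2$ and $s=3\delta-2$ for some $\delta\in\mathbb N$ (that is, $s\equiv 1 \bmod 3$). Then, for every choice of the root among the required vertices, $$\operatorname{opt}_{\mathcal{BCR}}(\operatorname{SI}_{d,s})\le\frac s3\Bigl(5d+1+\frac{d-1}s\Bigr),\qquad \operatorname{opt}_{\mathcal{BCR}^+}(\operatorname{SI}_{d,s})=2sd,$$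 $$\operatorname{gap}_{\mathcal{BCR},\mathcal{BCR}^+}(\operatorname{SI}_{d,s})\ge\frac{6d}{5d+1+\frac{d-1}s}.$$ Consequently, for every $d\ge 1$ and every choice of roots, $$\liminf_{\delta\to\infty}\operatorname{gap}_{\mathcal{BCR},\mathcal{BCR}^+}(\operatorname{SI}_{d,3\delta-2})\ge\frac{6d}{5d+1},\qquad\text{and}\qquad \operatorname{gap}_{\mathcal{BCR}_{\le d+1},\mathcal{BCR}^+_{\le d+1}}\ge\frac{6d}{5d+1}.$$ -/

import Mathlib

open scoped BigOperators

/-- A Steiner tree instance `(G, R, c)`: a finite simple undirected graph `G`, a set `R` of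
required vertices (terminals) and edge costs `c`. -/
structure SteinerInstance where
  V : Type
  [fintypeV : Fintype V]
  G : SimpleGraph V
  R : Finset V
  c : Sym2 V → ℝ

namespace SteinerInstance

attribute [instance] SteinerInstance.fintypeV

/-- The standing assumptions on a Steiner tree instance: the graph is connected, there is at least
one required vertex, and the edge costs are nonnegative. -/
structure IsValid (I : SteinerInstance) : Prop where
  connected : I.G.Connected
  nonempty : I.R.Nonempty
  cost_nonneg : ∀ e ∈ I.G.edgeSet, 0 ≤ I.c e

/-- The arcs of the bidirected graph: each edge `{v, w}` is replaced by the arcs `(v, w)` and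
`(w, v)`. -/
abbrev Arc (I : SteinerInstance) : Type := I.G.Dart

open Classical in
/-- `x(δ⁻(U))`, the total value of the arcs that enter `U`. -/
noncomputable def inflow (I : SteinerInstance) (x : I.Arc → ℝ) (U : Set I.V) : ℝ :=
  ∑ a : I.Arc with a.fst ∉ U ∧ a.snd ∈ U, x a

open Classical in
/-- `x(δ⁺(U))`, the total value of the arcs that leave `U`. -/
noncomputable def outflow (I : SteinerInstance) (x : I.Arc → ℝ) (U : Set I.V) : ℝ :=
  ∑ a : I.Arc with a.fst ∈ U ∧ a.snd ∉ U, x a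

open Classical in
/-- The objective `∑_{e = {v, w}} c(e) * (x(v, w) + x(w, v))`, as a sum over all arcs. -/
noncomputable def cost (I : SteinerInstance) (x : I.Arc → ℝ) : ℝ :=
  ∑ a : I.Arc, I.c a.edge * x a

/-- Feasible solutions of the bidirected cut relaxation with root `r`: every vertex set that
contains a required vertex but not the root is entered by at least one unit. -/
structure IsBCRFeasible (I : SteinerInstance) (r : I.V) (x : I.Arc → ℝ) : Prop where
  nonneg : ∀ a, 0 ≤ x a
  cut : ∀ U : Set I.V, r ∉ U → (∃ t ∈ I.R, t ∈ U) → 1 ≤ I.inflow x U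

/-- Feasible solutions of the strengthened relaxation: additionally, at every Steiner vertex
(a vertex that is not required) at least as much leaves as enters. -/
structure IsBCRPlusFeasible (I : SteinerInstance) (r : I.V) (x : I.Arc → ℝ) : Prop
    extends I.IsBCRFeasible r x where
  steiner : ∀ v, v ∉ I.R → I.inflow x {v} ≤ I.outflow x {v}

/-- The optimum value of the bidirected cut relaxation with root `r`. -/
noncomputable def optBCR (I : SteinerInstance) (r : I.V) : ℝ :=
  sInf {z | ∃ x, I.IsBCRFeasible r x ∧ I.cost x = z}

/-- The optimum value of the strengthened bidirected cut relaxation with root `r`. -/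
noncomputable def optBCRPlus (I : SteinerInstance) (r : I.V) : ℝ :=
  sInf {z | ∃ x, I.IsBCRPlusFeasible r x ∧ I.cost x = z}

/-- The gap between the two relaxations on one instance, i.e. the ratio of their optimum values
(with the convention `0 / 0 = 0`). -/
noncomputable def gap (I : SteinerInstance) (r : I.V) : ℝ :=
  I.optBCRPlus r / I.optBCR r

end SteinerInstance

/-- The worst-case gap between the two relaxations over all Steiner tree instances with at most `k`
required vertices (and all choices of the root among the required vertices). -/
noncomputable def worstGap (k : ℕ) : EReal :=
  ⨆ (I : SteinerInstance) (_ : I.IsValid) (_ : I.R.card ≤ k) (r : I.V) (_ : r ∈ I.R),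
    ((I.gap r : ℝ) : EReal)

/-- The discrete simplex: vectors in `ℤ_{≥0}^{d+1}` with coordinate sum `s`. -/
def discreteSimplex (d s : ℕ) : Finset (Fin (d + 1) → ℕ) :=
  Finset.piAntidiag Finset.univ s

/-- The vertices of the simplex graph: the points of the discrete simplices of sizes `s` and
`s + 1`, all of whose coordinates are at most `s`. -/
def simplexVertices (d s : ℕ) : Finset (Fin (d + 1) → ℕ) :=
  (discreteSimplex d s ∪ discreteSimplex d (s + 1)).filter fun v => ∀ i, v i ≤ s

/-- The distance `‖v - w‖₁`. -/
def l1Dist {d : ℕ} (v w : Fin (d + 1) → ℕ) : ℤ :=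
  ∑ i, |(v i : ℤ) - (w i : ℤ)|

theorem l1Dist_comm {d : ℕ} (v w : Fin (d + 1) → ℕ) : l1Dist v w = l1Dist w v :=
  Finset.sum_congr rfl fun _ _ => abs_sub_comm _ _

/-- The simplex graph: vertices are adjacent iff they have `L¹`-distance one. -/
def simplexGraph (d s : ℕ) : SimpleGraph (simplexVertices d s) where
  Adj v w := l1Dist v.1 w.1 = 1
  symm := ⟨fun v w h => by rwa [l1Dist_comm]⟩
  loopless := ⟨fun v h => by simp [l1Dist] at h⟩

/-- The required vertices: the corners `s • e_i`. -/
def simplexTerminals (d s : ℕ) : Finset (simplexVertices d s) :=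
  Finset.univ.filter fun v => ∃ i : Fin (d + 1), v.1 = Pi.single i s

/-- The simplex instance `SI_{d,s}`, whose edge costs are the `L¹`-distances. -/
def simplexInstance (d s : ℕ) : SteinerInstance where
  V := simplexVertices d s
  G := simplexGraph d s
  R := simplexTerminals d s
  c := Sym2.lift ⟨fun v w => ((l1Dist v.1 w.1 : ℤ) : ℝ), fun v w =>
    congrArg (fun z : ℤ => (z : ℝ)) (l1Dist_comm v.1 w.1)⟩

/-! Write `s = 3n + 1`. Every edge joins a lower vertex (coordinate sum `s`) to an upper vertex (sum
`s + 1`), so shifting a unit from one coordinate to another takes an upward and a downward arc.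

In the strengthened relaxation both kinds of arc must be paid for. For each non-root coordinate `t`,
the `s` cuts `v t ≥ k + 1` are entered only by upward arcs, and no arc enters two of all these cuts;
hence the upward arcs carry at least `s * d` (`le_sum_up`). Upper vertices are Steiner vertices, so
the downward arcs carry at least as much (`sum_up_le_sum_down`). Straight paths from the root attain
`2 * s * d`.

Without the extra constraints, several upward arcs can use one downward arc. A uniform distribution
on the points `(n + 1 + c) • e_i + (2 * n - c) • e_j` is routed to every corner. Flows to different
corners need not be added: one vector dominating each of them suffices, since reversing the flow to
the root makes it feasible at no cost (`isBCRFeasible_reroot`, `cost_reroot`). Counted separately,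
the arcs of a strand number `2 * s * d`. The routes are arranged so that for each of the `d - 1`
targets outside the support of a strand, `n` downward arcs coincide with downward arcs of routes to
other targets (`twin_spec`, `flow_le_cover`). The cost drops to `2 * s * d - (d - 1) * n`, which is
the claimed bound. -/

namespace SteinerInstance

/-! ### Net flow across cuts and change of root -/

open Classical in
/-- The net amount entering `U`, as a signed sum over all arcs. -/
theorem inflow_sub_outflow (I : SteinerInstance) (x : I.Arc → ℝ) (U : Set I.V) :
    I.inflow x U - I.outflow x U =
      ∑ a : I.Arc, x a * ((if a.snd ∈ U then 1 else 0) - (if a.fst ∈ U then 1 else 0)) := by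
  unfold inflow outflow
  rw [Finset.sum_filter, Finset.sum_filter, ← Finset.sum_sub_distrib]
  refine Finset.sum_congr rfl fun a _ => ?_
  by_cases h₁ : a.fst ∈ U <;> by_cases h₂ : a.snd ∈ U <;> simp [h₁, h₂]

theorem inflow_const_mul_sum (I : SteinerInstance) {ι : Type*} (s : Finset ι) (c : ℝ)
    (f : ι → I.Arc → ℝ) (U : Set I.V) :
    I.inflow (fun a => c * ∑ i ∈ s, f i a) U = c * ∑ i ∈ s, I.inflow (f i) U := by
  unfold inflow
  rw [← Finset.mul_sum, Finset.sum_comm]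

theorem outflow_const_mul_sum (I : SteinerInstance) {ι : Type*} (s : Finset ι) (c : ℝ)
    (f : ι → I.Arc → ℝ) (U : Set I.V) :
    I.outflow (fun a => c * ∑ i ∈ s, f i a) U = c * ∑ i ∈ s, I.outflow (f i) U := by
  unfold outflow
  rw [← Finset.mul_sum, Finset.sum_comm]

theorem inflow_mono (I : SteinerInstance) {x y : I.Arc → ℝ} (h : ∀ a, x a ≤ y a) (U : Set I.V) :
    I.inflow x U ≤ I.inflow y U :=
  Finset.sum_le_sum fun a _ => h a

theorem outflow_nonneg (I : SteinerInstance) {x : I.Arc → ℝ} (h : ∀ a, 0 ≤ x a) (U : Set I.V) :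
    0 ≤ I.outflow x U :=
  Finset.sum_nonneg fun a _ => h a

open Classical in
theorem sum_arc_symm (I : SteinerInstance) (g : I.Arc → ℝ) :
    ∑ a : I.Arc, g a.symm = ∑ a : I.Arc, g a :=
  Equiv.sum_comp (Function.Involutive.toPerm _ SimpleGraph.Dart.symm_involutive) g

theorem inflow_symm (I : SteinerInstance) (x : I.Arc → ℝ) (U : Set I.V) :
    I.inflow (fun a => x a.symm) U = I.outflow x U := by
  classical
  unfold inflow outflow
  rw [Finset.sum_filter, Finset.sum_filter, ← I.sum_arc_symm]
  refine Finset.sum_congr rfl fun a _ => ?_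
  simp [and_comm]

/-- Rerooting: if `f t` sends one unit from a common distribution `D` to the required vertex `τ t`,
for every `t`, and `y` dominates all these flows, then reversing `f r` yields a feasible solution
with root `τ r`. -/
theorem isBCRFeasible_reroot (I : SteinerInstance) {T : Type*} {τ : T → I.V}
    (hτ : ∀ v ∈ I.R, ∃ t, v = τ t) {y : I.Arc → ℝ} {f : T → I.Arc → ℝ} {D : Set I.V → ℝ}
    (hf : ∀ t a, 0 ≤ f t a) (hy : ∀ t a, f t a ≤ y a)
    (hD : ∀ t, ∀ U : Set I.V, τ t ∈ U → I.inflow (f t) U - I.outflow (f t) U = 1 - D U)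
    (hD' : ∀ t, ∀ U : Set I.V, τ t ∉ U → I.inflow (f t) U - I.outflow (f t) U = - D U) (r : T) :
    I.IsBCRFeasible (τ r) fun a => y a - f r a + f r a.symm := by
  refine ⟨fun a => by have := hy r a; have := hf r a.symm; linarith, ?_⟩
  rintro U hrU ⟨v, hv, hvU⟩
  obtain ⟨t, rfl⟩ := hτ v hv
  have h₁ : I.inflow (fun a => y a - f r a + f r a.symm) U =
      I.inflow y U - I.inflow (f r) U + I.outflow (f r) U := by
    rw [← I.inflow_symm (f r) U]
    simp only [inflow, Finset.sum_add_distrib, Finset.sum_sub_distrib]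
  -- The new inflow is at least the net inflow of `f t` minus that of `f r`, that is `(1 - D U) + D
  -- U`.
  have h₂ := I.inflow_mono (hy t) U
  have h₃ := I.outflow_nonneg (hf t) U
  have h₄ := hD t U hvU
  have h₅ := hD' r U hrU
  rw [h₁]
  linarith

/-- Both orientations of an edge cost the same, so reversing a flow is free. -/
theorem cost_reroot (I : SteinerInstance) (y g : I.Arc → ℝ) :
    I.cost (fun a => y a - g a + g a.symm) = I.cost y := by
  unfold cost
  have h := I.sum_arc_symm fun a => I.c a.edge * g a
  simp only [SimpleGraph.Dart.edge_symm] at h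
  simp only [mul_add, mul_sub, Finset.sum_add_distrib, Finset.sum_sub_distrib, h]
  ring

end SteinerInstance

/-! ### Tracks in the simplex graph and their unit flows -/

section Simplex

theorem mem_simplexVertices {d s : ℕ} {v : Fin (d + 1) → ℕ} :
    v ∈ simplexVertices d s ↔ (∑ i, v i = s ∨ ∑ i, v i = s + 1) ∧ ∀ i, v i ≤ s := by
  simp [simplexVertices, discreteSimplex, Finset.mem_piAntidiag]

theorem l1Dist_add_single {d : ℕ} (v : Fin (d + 1) → ℕ) (g : Fin (d + 1)) :
    l1Dist v (v + Pi.single g 1) = 1 := by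
  unfold l1Dist
  rw [Finset.sum_eq_single g]
  · simp
  · intro b _ hb
    simp [hb]
  · simp

theorem sum_single_one {d : ℕ} (g : Fin (d + 1)) :
    ∑ i, (Pi.single g 1 : Fin (d + 1) → ℕ) i = 1 := by
  simp

/-- A track towards the corner `t`: a sequence of points of the discrete simplex whose `k`-th point
has `t`-coordinate `k`, one unit being shifted from another coordinate to `t` in every step. -/
structure Track (d s : ℕ) (t : Fin (d + 1)) where
  seq : ℕ → Fin (d + 1) → ℕ
  sum_seq : ∀ k ≤ s, ∑ i, seq k i = s
  apply_target : ∀ k ≤ s, seq k t = k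
  step : ∀ k < s, ∃ g, seq (k + 1) + Pi.single g 1 = seq k + Pi.single t 1

namespace Track

variable {d s : ℕ} {t : Fin (d + 1)}

theorem seq_le (T : Track d s t) {k : ℕ} (hk : k ≤ s) (i : Fin (d + 1)) : T.seq k i ≤ s :=
  (Finset.single_le_sum (fun _ _ => Nat.zero_le _) (Finset.mem_univ i)).trans (T.sum_seq k hk).le

/-- The `k`-th point of a track. -/
def vertex (T : Track d s t) (k : ℕ) (hk : k ≤ s) : (simplexInstance d s).V :=
  ⟨T.seq k, mem_simplexVertices.2 ⟨Or.inl (T.sum_seq k hk), T.seq_le hk⟩⟩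

/-- The upper vertex between the points `k` and `k + 1` of a track. -/
def upper (T : Track d s t) (k : Fin s) : (simplexInstance d s).V :=
  ⟨T.seq k + Pi.single t 1, mem_simplexVertices.2 ⟨Or.inr (by
    simp only [Pi.add_apply, Finset.sum_add_distrib, T.sum_seq k k.2.le, sum_single_one]),
    fun i => by
      rcases eq_or_ne i t with rfl | h
      · simp [T.apply_target k k.2.le]
      · simpa [h] using T.seq_le k.2.le i⟩⟩

/-- The arc by which a track leaves its `k`-th point. -/
def up (T : Track d s t) (k : Fin s) : (simplexInstance d s).Arc where
  fst := T.vertex k k.2.le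
  snd := T.upper k
  adj := l1Dist_add_single _ _

/-- The arc by which a track enters its point `k + 1`. -/
def down (T : Track d s t) (k : Fin s) : (simplexInstance d s).Arc where
  fst := T.upper k
  snd := T.vertex (k + 1) k.2
  adj := by
    obtain ⟨g, hg⟩ := T.step k k.2
    change l1Dist (T.seq k + Pi.single t 1) (T.seq (k + 1)) = 1
    rw [l1Dist_comm, ← hg, l1Dist_add_single]

open Classical in
/-- The unit flow along a track, from its point with number `a` on. -/
noncomputable def flow (T : Track d s t) (a : ℕ) (e : (simplexInstance d s).Arc) : ℝ :=
  ∑ k : Fin s, if a ≤ k then (if T.up k = e then 1 else 0) + (if T.down k = e then 1 else 0) else 0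

theorem flow_nonneg (T : Track d s t) (a : ℕ) (e : (simplexInstance d s).Arc) : 0 ≤ T.flow a e :=
  Finset.sum_nonneg fun k _ => by split_ifs <;> norm_num

theorem sum_range_telescope (h : ℕ → ℝ) {a m : ℕ} (ham : a ≤ m) :
    ∑ k ∈ Finset.range m, (if a ≤ k then h (k + 1) - h k else 0) = h m - h a := by
  induction m, ham using Nat.le_induction with
  | base =>
    rw [sub_self]
    exact Finset.sum_eq_zero fun k hk => if_neg (not_le.2 (Finset.mem_range.1 hk))
  | succ m hm ih => rw [Finset.sum_range_succ, ih, if_pos hm]; ring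

open Classical in
theorem sum_flow_mul (T : Track d s t) (a : ℕ) (g : (simplexInstance d s).Arc → ℝ) :
    ∑ e, T.flow a e * g e = ∑ k : Fin s, if a ≤ k then g (T.up k) + g (T.down k) else 0 := by
  simp only [flow, Finset.sum_mul]
  rw [Finset.sum_comm]
  refine Finset.sum_congr rfl fun k _ => ?_
  split_ifs with h
  · simp [add_mul, Finset.sum_add_distrib]
  · simp

open Classical in
-- The upper vertex cancels within each step, and the remaining differences of indicators telescope
-- along the track.
theorem flow_net (T : Track d s t) {a : ℕ} (ha : a ≤ s) (U : Set (simplexInstance d s).V) :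
    (simplexInstance d s).inflow (T.flow a) U - (simplexInstance d s).outflow (T.flow a) U =
      (if T.vertex s le_rfl ∈ U then 1 else 0) - (if T.vertex a ha ∈ U then 1 else 0) := by
  rw [SteinerInstance.inflow_sub_outflow, sum_flow_mul]
  -- The indicator is extended by zero beyond `s` only to have a function on `ℕ`; the telescoping
  -- sum never reaches these values.
  set h : ℕ → ℝ := fun k => if hk : k ≤ s then (if T.vertex k hk ∈ U then 1 else 0) else 0 with hh
  have key := sum_range_telescope h ha
  rw [← Fin.sum_univ_eq_sum_range fun k => if a ≤ k then h (k + 1) - h k else 0] at key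
  simp only [hh, le_refl, ha, dif_pos] at key
  rw [← key]
  refine Finset.sum_congr rfl fun k _ => ?_
  by_cases hk : a ≤ (k : ℕ)
  · have h₁ : (k : ℕ) ≤ s := k.2.le
    have h₂ : (k : ℕ) + 1 ≤ s := k.2
    rw [if_pos hk, if_pos hk, dif_pos h₁, dif_pos h₂]
    exact (by intros; ring : ∀ x y z : ℝ, x - y + (z - x) = z - y) _ _ _
  · rw [if_neg hk, if_neg hk]

end Track

/-- The required vertex `s • e_t`. -/
def corner (d s : ℕ) (t : Fin (d + 1)) : (simplexInstance d s).V :=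
  ⟨Pi.single t s, mem_simplexVertices.2 ⟨Or.inl (by simp), fun i => by
    rcases eq_or_ne i t with rfl | h <;> simp [*]⟩⟩

theorem mem_simplexTerminals {d s : ℕ} {v : simplexVertices d s} :
    v ∈ simplexTerminals d s ↔ ∃ t, v.1 = Pi.single t s := by
  simp [simplexTerminals]

theorem mem_R_iff {d s : ℕ} {v : (simplexInstance d s).V} :
    v ∈ (simplexInstance d s).R ↔ ∃ t, v = corner d s t := by
  refine (mem_simplexTerminals (v := v)).trans ?_
  exact ⟨fun ⟨t, h⟩ => ⟨t, Subtype.ext h⟩, fun ⟨t, h⟩ => ⟨t, congrArg Subtype.val h⟩⟩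

theorem corner_mem_R (d s : ℕ) (t : Fin (d + 1)) : corner d s t ∈ (simplexInstance d s).R :=
  mem_R_iff.2 ⟨t, rfl⟩

theorem corner_injective {d s : ℕ} (hs : s ≠ 0) : Function.Injective (corner d s) := by
  intro i j h
  by_contra hij
  have := congrFun (congrArg Subtype.val h) i
  simp [corner, hij] at this
  exact hs this

theorem Track.vertex_last {d s : ℕ} {t : Fin (d + 1)} (T : Track d s t) :
    T.vertex s le_rfl = corner d s t := by
  refine Subtype.ext (funext fun i => ?_)
  have h₁ := T.sum_seq s le_rfl
  have h₂ := T.apply_target s le_rfl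
  rw [← Finset.add_sum_erase _ _ (Finset.mem_univ t), h₂] at h₁
  have h₃ : ∑ i ∈ Finset.univ.erase t, T.seq s i = 0 := by omega
  change T.seq s i = (Pi.single t s : Fin (d + 1) → ℕ) i
  rcases eq_or_ne i t with rfl | h
  · simp [h₂]
  · rw [Finset.sum_eq_zero_iff] at h₃
    simpa [h] using h₃ i (by simp [h])

theorem c_edge {d s : ℕ} (a : (simplexInstance d s).Arc) : (simplexInstance d s).c a.edge = 1 := by
  have h : l1Dist a.fst.1 a.snd.1 = 1 := a.adj
  change ((l1Dist a.fst.1 a.snd.1 : ℤ) : ℝ) = 1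
  rw [h, Int.cast_one]

open Classical in
theorem cost_eq_sum {d s : ℕ} (x : (simplexInstance d s).Arc → ℝ) :
    (simplexInstance d s).cost x = ∑ a, x a := by
  simp only [SteinerInstance.cost, c_edge, one_mul]

end Simplex

/-! ### Strands and the downward arcs that their tracks share -/

/-- The track `k ↦ k • e_t + J k • e_j + (s - k - J k) • e_i`. -/
def Track.bend {d s : ℕ} {t : Fin (d + 1)} (i j : Fin (d + 1)) (J : ℕ → ℕ)
    (hJ : ∀ k ≤ s, k + J k ≤ s) (hstep : ∀ k < s, J (k + 1) = J k ∨ J k = J (k + 1) + 1)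
    (hi : i = t → ∀ k ≤ s, k + J k = s) (hj : j = t → ∀ k ≤ s, J k = 0) : Track d s t where
  seq k := Pi.single t k + Pi.single j (J k) + Pi.single i (s - k - J k)
  sum_seq k hk := by
    have := hJ k hk
    simp only [Pi.add_apply, Finset.sum_add_distrib, Finset.sum_pi_single', Finset.mem_univ,
      if_true]
    omega
  apply_target k hk := by
    have h₁ : (Pi.single j (J k) : Fin (d + 1) → ℕ) t = 0 := by
      rcases eq_or_ne j t with h | h
      · simp [hj h k hk]
      · simp [h.symm]
    have h₂ : (Pi.single i (s - k - J k) : Fin (d + 1) → ℕ) t = 0 := by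
      rcases eq_or_ne i t with h | h
      · have := hi h k hk
        rw [show s - k - J k = 0 by omega]
        simp
      · simp [h.symm]
    simp [h₁, h₂]
  step k hk := by
    have h₀ := hJ (k + 1) hk
    rcases hstep k hk with h | h
    · refine ⟨i, ?_⟩
      rw [h, show s - k - J k = (s - (k + 1) - J k) + 1 by omega, Pi.single_add, Pi.single_add]
      abel
    · refine ⟨j, ?_⟩
      rw [h, show s - k - (J (k + 1) + 1) = s - (k + 1) - J (k + 1) by omega, Pi.single_add,
        Pi.single_add]
      abel

/-- The strands of the common distribution: an ordered pair `(i, j)` of distinct coordinates and a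
number `c`, for the point `(n + 1 + c) • e_i + (2 * n - c) • e_j`. -/
abbrev Strand (d n : ℕ) : Type := (Σ i : Fin (d + 1), {j : Fin (d + 1) // j ≠ i}) × Fin n

namespace Strand

variable {d n : ℕ}

/-- The `j`-coordinate along the track of a strand towards `t`. -/
def height (t : Fin (d + 1)) (σ : Strand d n) (k : ℕ) : ℕ :=
  -- Truncated subtraction encodes the three phases of the last case: `k - n` vanishes for the first
  -- `n` steps, and the height stays `0` once `j` is used up.
  if t = σ.1.1 then 3 * n + 1 - k else if t = σ.1.2.1 then 0 else 2 * n - σ.2 - (k - n)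

/-- The track that leads the strand `σ` to the corner `t`: it first takes `n` units from `i`, then
all of `j`, then the rest of `i`. -/
def track (t : Fin (d + 1)) (σ : Strand d n) : Track d (3 * n + 1) t :=
  Track.bend σ.1.1 σ.1.2.1 (height t σ)
    (by
      intro k hk
      have := σ.2.2
      unfold height
      split_ifs <;> omega)
    (by
      intro k hk
      unfold height
      split_ifs <;> omega)
    (by
      intro h k hk
      rw [height, if_pos h.symm]
      omega)
    (by
      intro h k hk
      have h' : t ≠ σ.1.1 := fun h' => σ.1.2.2 (h.trans h')
      rw [height, if_neg h', if_pos h.symm])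

theorem track_seq (t : Fin (d + 1)) (σ : Strand d n) (k : ℕ) :
    (track t σ).seq k = Pi.single t k + Pi.single σ.1.2.1 (height t σ k) +
      Pi.single σ.1.1 (3 * n + 1 - k - height t σ k) :=
  rfl

/-- The number of the point of `track t σ` where the strand starts. -/
def start (t : Fin (d + 1)) (σ : Strand d n) : ℕ :=
  if t = σ.1.1 then n + 1 + σ.2 else if t = σ.1.2.1 then 2 * n - σ.2 else 0

theorem start_le (t : Fin (d + 1)) (σ : Strand d n) : start t σ ≤ 3 * n + 1 := by
  have := σ.2.2
  unfold start
  split_ifs <;> omega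

/-- The point where a strand starts. -/
def point (σ : Strand d n) : Fin (d + 1) → ℕ :=
  Pi.single σ.1.1 (n + 1 + σ.2) + Pi.single σ.1.2.1 (2 * n - σ.2)

theorem track_start (t : Fin (d + 1)) (σ : Strand d n) :
    (track t σ).seq (start t σ) = point σ := by
  obtain ⟨⟨i, j, hij⟩, c⟩ := σ
  have hc := c.2
  rw [track_seq]
  unfold start height point
  dsimp only
  rcases eq_or_ne t i with rfl | hi
  · rw [if_pos rfl, if_pos rfl, show 3 * n + 1 - (n + 1 + (c : ℕ)) = 2 * n - c by omega]
    simp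
  · rcases eq_or_ne t j with rfl | hj
    · rw [if_neg hi, if_neg hi, if_pos rfl, if_pos rfl,
        show 3 * n + 1 - (2 * n - (c : ℕ)) - 0 = n + 1 + c by omega, Pi.single_zero, add_zero]
      exact add_comm _ _
    · rw [if_neg hi, if_neg hi, if_neg hj, if_neg hj,
        show 2 * n - (c : ℕ) - (0 - n) = 2 * n - c by omega,
        show 3 * n + 1 - 0 - (2 * n - (c : ℕ)) = n + 1 + c by omega, Pi.single_zero, zero_add]
      exact add_comm _ _

/-- The steps of `track t σ` whose downward arcs are shared with another strand. -/
def Shared (t : Fin (d + 1)) (σ : Strand d n) (k : ℕ) : Prop :=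
  -- In this window the track takes from `j` while its `i`-coordinate stays at `c + 1`. Its length
  -- `n` makes `2 * n - 1 - k` a valid strand number.
  (t ≠ σ.1.1 ∧ t ≠ σ.1.2.1) ∧ n ≤ k ∧ k < 2 * n

/-- The target, strand and step whose downward arc coincides with that of the shared step `p` of a
track towards `t`. -/
def twin (t : Fin (d + 1)) (p : Strand d n × Fin (3 * n + 1)) :
    Fin (d + 1) × Strand d n × Fin (3 * n + 1) :=
  if h : t ≠ p.1.1.2.1 ∧ n ≤ p.2 ∧ (p.2 : ℕ) < 2 * n then
    (p.1.1.1, (⟨p.1.1.2.1, ⟨t, h.1⟩⟩, ⟨2 * n - 1 - p.2, by omega⟩),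
      ⟨p.1.2, p.1.2.2.trans (by omega)⟩)
  else (t, p)

theorem twin_mk {t i j : Fin (d + 1)} {hij : j ≠ i} {c : Fin n} {k : Fin (3 * n + 1)}
    (hj : t ≠ j) (hk : n ≤ k) (hk' : (k : ℕ) < 2 * n) :
    twin t ((⟨i, ⟨j, hij⟩⟩, c), k) =
      (i, (⟨j, ⟨t, hj⟩⟩, ⟨2 * n - 1 - k, by omega⟩), ⟨c, c.2.trans (by omega)⟩) :=
  dif_pos (c := t ≠ j ∧ n ≤ k ∧ (k : ℕ) < 2 * n) ⟨hj, hk, hk'⟩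

/-- The twin remembers everything: `i` is its target, `j` the first coordinate of its strand, `k` is
read off its strand number, and `c` is its step. -/
theorem twin_injOn (t : Fin (d + 1)) :
    Set.InjOn (twin t) {p : Strand d n × Fin (3 * n + 1) | Shared t p.1 p.2} := by
  rintro ⟨⟨⟨i, j, hij⟩, c⟩, k⟩ ⟨⟨-, hj⟩, hk, hk'⟩ ⟨⟨⟨i', j', hij'⟩, c'⟩, k'⟩ ⟨⟨-, hj'⟩, hl, hl'⟩ h
  dsimp only at hj hj' hk hk' hl hl'
  rw [twin_mk hj hk hk', twin_mk hj' hl hl'] at h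
  simp only [Prod.mk.injEq, Sigma.mk.injEq, Fin.mk.injEq] at h
  obtain ⟨rfl, ⟨⟨rfl, -⟩, h₁⟩, h₂⟩ := h
  have h₃ : c = c' := Fin.ext h₂
  have h₄ : k = k' := Fin.ext (by omega)
  rw [h₃, h₄]

/-- At the shared step `k`, the track is at `k • e_t + (3 * n - k - c) • e_j + (c + 1) • e_i`. The
strand `(j, t)` with number `2 * n - 1 - k` starts at `(3 * n - k) • e_j + (k + 1) • e_t`; after `c`
steps towards `i` it is at `c • e_i + (3 * n - k - c) • e_j + (k + 1) • e_t`. Both tracks thus rise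
to the same upper vertex and then drop a unit of `j`. Since `c < n`, the twin step lies before the
shared window. -/
theorem twin_spec {t : Fin (d + 1)} {p : Strand d n × Fin (3 * n + 1)} (h : Shared t p.1 p.2) :
    (twin t p).1 ≠ t ∧ start (twin t p).1 (twin t p).2.1 ≤ (twin t p).2.2 ∧
      ¬ Shared (twin t p).1 (twin t p).2.1 (twin t p).2.2 ∧
      (track (twin t p).1 (twin t p).2.1).down (twin t p).2.2 = (track t p.1).down p.2 := by
  obtain ⟨⟨⟨i, j, hij⟩, c⟩, k⟩ := p
  obtain ⟨⟨hi, hj⟩, hk, hk'⟩ := h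
  dsimp only at hi hj hk hk'
  have hc := c.2
  rw [twin_mk hj hk hk']
  dsimp only
  refine ⟨hi.symm, ?_, ?_, ?_⟩
  · unfold start
    dsimp only
    rw [if_neg hij.symm, if_neg hi.symm]
    exact Nat.zero_le _
  · rintro ⟨-, h, -⟩
    omega
  · have e₁ : ∀ l ≤ n, height i ((⟨j, ⟨t, hj⟩⟩, ⟨2 * n - 1 - k, by omega⟩) : Strand d n) l =
        k + 1 := by
      intro l hl
      unfold height
      dsimp only
      rw [if_neg hij.symm, if_neg hi.symm]
      omega
    have e₂ : ∀ l, height t ((⟨i, ⟨j, hij⟩⟩, c) : Strand d n) l = 2 * n - c - (l - n) := by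
      intro l
      unfold height
      dsimp only
      rw [if_neg hi, if_neg hj]
    rw [SimpleGraph.Dart.ext_iff]
    refine Prod.ext (Subtype.ext ?_) (Subtype.ext ?_)
    · change (track i _).seq c + Pi.single i 1 = (track t _).seq k + Pi.single t 1
      rw [track_seq, track_seq, e₁ c hc.le, e₂]
      dsimp only
      rw [show 3 * n + 1 - (c : ℕ) - (k + 1) = 2 * n - c - (k - n) by omega,
        show 3 * n + 1 - (k : ℕ) - (2 * n - c - (k - n)) = c + 1 by omega, Pi.single_add,
        Pi.single_add]
      abel
    · change (track i _).seq (c + 1) = (track t _).seq (k + 1)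
      rw [track_seq, track_seq, e₁ (c + 1) hc, e₂]
      dsimp only
      rw [show 3 * n + 1 - ((c : ℕ) + 1) - (k + 1) = 2 * n - c - (k + 1 - n) by omega,
        show 3 * n + 1 - ((k : ℕ) + 1) - (2 * n - c - (k + 1 - n)) = c + 1 by omega]
      abel

/-! ### The dominating vector and its total value -/

/-- Points of a track are numbered by their `t`-coordinate. Hence the starting numbers of a strand
sum to `s`, and its tracks to all corners have `s * d` steps in total. -/
theorem start_eq_point (t : Fin (d + 1)) (σ : Strand d n) : start t σ = point σ t := by
  rw [← track_start t σ, (track t σ).apply_target _ (start_le t σ)]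

theorem sum_start (σ : Strand d n) : ∑ t, start t σ = 3 * n + 1 := by
  simp only [start_eq_point, point, Pi.add_apply, Finset.sum_add_distrib, Finset.sum_pi_single',
    Finset.mem_univ, if_true]
  have := σ.2.2
  omega

theorem start_of_shared {t : Fin (d + 1)} {σ : Strand d n} {k : ℕ} (h : Shared t σ k) :
    start t σ = 0 := by
  rw [start, if_neg h.1.1, if_neg h.1.2]

/-- The sum of the flows that lead all the strands to the corner `t`. -/
noncomputable def flow (t : Fin (d + 1)) (e : (simplexInstance d (3 * n + 1)).Arc) : ℝ :=
  ∑ σ : Strand d n, (track t σ).flow (start t σ) e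

open Classical in
/-- A vector that dominates all the flows: shared downward arcs are counted only once. -/
noncomputable def cover (d n : ℕ) (e : (simplexInstance d (3 * n + 1)).Arc) : ℝ :=
  ∑ t : Fin (d + 1), ∑ σ : Strand d n, ∑ k : Fin (3 * n + 1),
    if start t σ ≤ k then
      (if (track t σ).up k = e then 1 else 0) +
        (if Shared t σ k then 0 else if (track t σ).down k = e then 1 else 0)
    else 0

theorem flow_nonneg (t : Fin (d + 1)) (e : (simplexInstance d (3 * n + 1)).Arc) :
    0 ≤ flow t e :=
  Finset.sum_nonneg fun σ _ => (track t σ).flow_nonneg _ e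

open Classical in
-- `twin` injects the shared steps of the tracks to `t` that use `e` into the unshared steps of
-- tracks to other targets that use `e`.
theorem sum_shared_le (t : Fin (d + 1)) (e : (simplexInstance d (3 * n + 1)).Arc) :
    ∑ σ : Strand d n, ∑ k : Fin (3 * n + 1),
        (if Shared t σ k ∧ (track t σ).down k = e then (1 : ℝ) else 0) ≤
      ∑ t' ∈ Finset.univ.erase t, ∑ σ : Strand d n, ∑ k : Fin (3 * n + 1),
        (if start t' σ ≤ k ∧ ¬ Shared t' σ k ∧ (track t' σ).down k = e then (1 : ℝ) else 0) := by
  simp only [← Finset.univ_product_univ, ← Finset.sum_product']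
  rw [← Finset.sum_filter, ← Finset.sum_filter, Finset.sum_const, Finset.sum_const, nsmul_one,
    nsmul_one, Nat.cast_le]
  refine Finset.card_le_card_of_injOn (twin t) ?_ ?_
  · rintro p hp
    simp only [Finset.coe_filter, Finset.mem_product, Finset.mem_univ, Set.mem_ofPred_eq,
      true_and] at hp
    obtain ⟨h₁, h₂, h₃, h₄⟩ := twin_spec hp.1
    simp only [Finset.coe_filter, Finset.mem_product, Finset.mem_univ, Finset.mem_erase,
      Set.mem_ofPred_eq, and_true]
    exact ⟨h₁, h₂, h₃, h₄.trans hp.2⟩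
  · refine (twin_injOn t).mono fun p hp => ?_
    simp only [Finset.coe_filter, Finset.mem_product, Finset.mem_univ, Set.mem_ofPred_eq,
      true_and] at hp
    exact hp.1

/-- The unshared part of the flow to `t` is the summand of `cover` for `t` itself; the shared
downward arcs are paid for by the summands of the other targets. -/
theorem flow_le_cover (t : Fin (d + 1)) (e : (simplexInstance d (3 * n + 1)).Arc) :
    flow t e ≤ cover d n e := by
  classical
  unfold cover
  rw [← Finset.add_sum_erase _ _ (Finset.mem_univ t)]
  have h₁ : flow t e = (∑ σ : Strand d n, ∑ k : Fin (3 * n + 1),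
      if start t σ ≤ k then
        (if (track t σ).up k = e then (1 : ℝ) else 0) +
          (if Shared t σ k then 0 else if (track t σ).down k = e then 1 else 0)
      else 0) + ∑ σ : Strand d n, ∑ k : Fin (3 * n + 1),
        (if Shared t σ k ∧ (track t σ).down k = e then (1 : ℝ) else 0) := by
    simp only [← Finset.sum_add_distrib, flow, Track.flow]
    refine Finset.sum_congr rfl fun σ _ => Finset.sum_congr rfl fun k _ => ?_
    by_cases hS : Shared t σ k
    · simp [hS, start_of_shared hS]
    · simp [hS]
  rw [h₁]
  refine add_le_add_right ((sum_shared_le t e).trans ?_) _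
  refine Finset.sum_le_sum fun t' _ => Finset.sum_le_sum fun σ _ => Finset.sum_le_sum fun k _ => ?_
  by_cases h₁ : start t' σ ≤ k
  · by_cases h₂ : Shared t' σ k
    · simp only [h₁, h₂, not_true_eq_false, false_and, and_false, if_true, if_false]
      split_ifs <;> norm_num
    · simp only [h₁, h₂, not_false_eq_true, true_and, if_true, if_false]
      exact le_add_of_nonneg_left (by split_ifs <;> norm_num)
  · simp only [h₁, false_and, if_false, le_refl]

theorem sum_range_ite (m a b : ℕ) (hab : a ≤ b) (hb : b ≤ m) (x : ℝ) :
    ∑ k ∈ Finset.range m, (if a ≤ k ∧ k < b then x else 0) = (b - a) * x := by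
  rw [← Finset.sum_filter, show (Finset.range m).filter (fun k => a ≤ k ∧ k < b) =
    Finset.Ico a b by ext k; simp; omega, Finset.sum_const, Nat.card_Ico, nsmul_eq_mul,
    Nat.cast_sub hab]

open Classical in
-- A target `t` costs two arcs for each of the `s - start t σ` steps, less the `n` shared arcs when
-- `t` is one of the `d - 1` coordinates outside the support of the strand.
theorem sum_weight (σ : Strand d n) :
    ∑ t : Fin (d + 1), ∑ k : Fin (3 * n + 1),
      (if start t σ ≤ k then (1 : ℝ) + (if Shared t σ k then 0 else 1) else 0) =
      2 * (3 * n + 1) * d - (d - 1) * n := by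
  have h₁ : ∀ t : Fin (d + 1), ∑ k : Fin (3 * n + 1),
      (if start t σ ≤ k then (1 : ℝ) + (if Shared t σ k then 0 else 1) else 0) =
      2 * ((3 * n + 1) - start t σ) -
        (n - ((if t = σ.1.1 then (n : ℝ) else 0) + if t = σ.1.2.1 then (n : ℝ) else 0)) := by
    intro t
    have h₂ := sum_range_ite (3 * n + 1) (start t σ) (3 * n + 1) (start_le t σ) le_rfl 2
    have h₃ := sum_range_ite (3 * n + 1) n (2 * n) (by omega) (by omega) 1
    rw [← Fin.sum_univ_eq_sum_range (fun k => if start t σ ≤ k ∧ k < 3 * n + 1 then (2 : ℝ) else 0)]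
      at h₂
    rw [← Fin.sum_univ_eq_sum_range (fun k => if n ≤ k ∧ k < 2 * n then (1 : ℝ) else 0)] at h₃
    -- As `i ≠ j`, at most one of the two conditionals is active, and the right side is `0` or `n`.
    have h₄ : ∑ k : Fin (3 * n + 1), (if Shared t σ k then (1 : ℝ) else 0) =
        n - ((if t = σ.1.1 then (n : ℝ) else 0) + if t = σ.1.2.1 then (n : ℝ) else 0) := by
      by_cases hi : t = σ.1.1
      · have hj : t ≠ σ.1.2.1 := fun h => σ.1.2.2 (h.symm.trans hi)
        simp only [Shared, hi, hi ▸ hj, ne_eq, not_true_eq_false, false_and, if_true, if_false,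
          Finset.sum_const_zero]
        ring
      · by_cases hj : t = σ.1.2.1
        · simp [Shared, hj, hj ▸ hi]
        · simp only [Shared, hi, hj, ne_eq, not_false_eq_true, true_and, if_false, h₃]
          push_cast
          ring
    rw [← h₄, show 2 * ((3 * (n : ℝ) + 1) - start t σ) =
      (((3 * n + 1 : ℕ) : ℝ) - start t σ) * 2 by push_cast; ring, ← h₂, ← Finset.sum_sub_distrib]
    refine Finset.sum_congr rfl fun k _ => ?_
    have hk := k.2
    by_cases hS : Shared t σ k
    · rw [start_of_shared hS, if_pos (Nat.zero_le _), if_pos hS, if_pos ⟨Nat.zero_le _, hk⟩,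
        if_pos hS]
      norm_num
    · rw [if_neg hS, if_neg hS]
      by_cases hs : start t σ ≤ k
      · rw [if_pos hs, if_pos ⟨hs, hk⟩]
        norm_num
      · rw [if_neg hs, if_neg fun h => hs h.1, sub_zero]
  have h₅ : ∑ t, (start t σ : ℝ) = 3 * n + 1 := by exact_mod_cast sum_start σ
  rw [Finset.sum_congr rfl fun t _ => h₁ t]
  simp only [Finset.sum_sub_distrib, ← Finset.mul_sum, Finset.sum_add_distrib, h₅,
    Finset.sum_const, Finset.card_univ, Fintype.card_fin, nsmul_eq_mul, Finset.sum_ite_eq',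
    Finset.mem_univ, if_true]
  push_cast
  ring

open Classical in
theorem sum_cover : ∑ e, cover d n e =
    Fintype.card (Strand d n) * (2 * (3 * n + 1) * d - (d - 1) * n : ℝ) := by
  have h : ∀ (t : Fin (d + 1)) (σ : Strand d n) (k : Fin (3 * n + 1)),
      (∑ e, if start t σ ≤ k then
        (if (track t σ).up k = e then (1 : ℝ) else 0) +
          (if Shared t σ k then 0 else if (track t σ).down k = e then 1 else 0)
      else 0) =
      if start t σ ≤ k then (1 : ℝ) + (if Shared t σ k then 0 else 1) else 0 := by
    intro t σ k
    split_ifs <;> simp [Finset.sum_add_distrib]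
  unfold cover
  rw [Finset.sum_comm]
  simp only [Finset.sum_comm (s := (Finset.univ : Finset (simplexInstance d (3 * n + 1)).Arc)), h]
  rw [Finset.sum_comm]
  simp only [sum_weight, Finset.sum_const, Finset.card_univ, nsmul_eq_mul]

end Strand

/-! ### The cheap solution of the bidirected cut relaxation -/

theorem optBCR_le_cost {I : SteinerInstance} {r : I.V} {x : I.Arc → ℝ} (hI : I.IsValid)
    (hx : I.IsBCRFeasible r x) : I.optBCR r ≤ I.cost x := by
  refine csInf_le ⟨0, ?_⟩ ⟨x, hx, rfl⟩
  rintro _ ⟨y, hy, rfl⟩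
  exact Finset.sum_nonneg fun a _ => mul_nonneg (hI.cost_nonneg _ a.edge_mem) (hy.nonneg a)

open Classical in
/-- A feasible solution of the bidirected cut relaxation in which pairs of strands share arcs. -/
theorem exists_isBCRFeasible (d n : ℕ) (hd : 1 ≤ d) (hn : 1 ≤ n) (r : Fin (d + 1)) :
    ∃ x, (simplexInstance d (3 * n + 1)).IsBCRFeasible (corner d (3 * n + 1) r) x ∧
      (simplexInstance d (3 * n + 1)).cost x = 2 * (3 * n + 1) * d - (d - 1) * n := by
  have hne : Nonempty (Strand d n) :=
    ⟨(⟨0, ⟨Fin.last d, fun h => by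
      have h' : d = 0 := congrArg Fin.val h
      omega⟩⟩, ⟨0, hn⟩)⟩
  set ρ : ℝ := (Fintype.card (Strand d n) : ℝ)⁻¹ with hρ
  have hcard : (0 : ℝ) < Fintype.card (Strand d n) := by exact_mod_cast Fintype.card_pos
  have hρ₀ : 0 ≤ ρ := by positivity
  -- Defining the starting points by the tracks to `r` is an arbitrary choice: by `track_start` they
  -- do not depend on the target, so all flows leave the same distribution.
  let P : Strand d n → (simplexInstance d (3 * n + 1)).V := fun σ =>
    (Strand.track r σ).vertex _ (Strand.start_le r σ)
  have hnet : ∀ (t : Fin (d + 1)) (U : Set (simplexInstance d (3 * n + 1)).V),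
      (simplexInstance d (3 * n + 1)).inflow (fun e => ρ * Strand.flow t e) U -
        (simplexInstance d (3 * n + 1)).outflow (fun e => ρ * Strand.flow t e) U =
      (if corner d (3 * n + 1) t ∈ U then 1 else 0) - ρ * ∑ σ, if P σ ∈ U then 1 else 0 := by
    intro t U
    have hP : ∀ σ, (Strand.track t σ).vertex _ (Strand.start_le t σ) = P σ := fun σ =>
      Subtype.ext ((Strand.track_start t σ).trans (Strand.track_start r σ).symm)
    unfold Strand.flow
    rw [SteinerInstance.inflow_const_mul_sum, SteinerInstance.outflow_const_mul_sum, ← mul_sub,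
      ← Finset.sum_sub_distrib, Finset.sum_congr rfl fun σ _ =>
        (Strand.track t σ).flow_net (Strand.start_le t σ) U]
    simp only [hP, Track.vertex_last, Finset.sum_sub_distrib, mul_sub, Finset.sum_const,
      Finset.card_univ, nsmul_eq_mul, ← mul_assoc]
    rw [hρ, inv_mul_cancel₀ hcard.ne', one_mul]
  refine ⟨_, SteinerInstance.isBCRFeasible_reroot _ (τ := corner d (3 * n + 1))
    (fun v hv => mem_R_iff.1 hv) (y := fun e => ρ * Strand.cover d n e)
    (f := fun t e => ρ * Strand.flow t e) (D := fun U => ρ * ∑ σ, if P σ ∈ U then 1 else 0)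
    (fun t e => mul_nonneg hρ₀ (Strand.flow_nonneg t e))
    (fun t e => mul_le_mul_of_nonneg_left (Strand.flow_le_cover t e) hρ₀)
    (fun t U h => by rw [hnet, if_pos h]) (fun t U h => by rw [hnet, if_neg h, zero_sub]) r, ?_⟩
  rw [SteinerInstance.cost_reroot, cost_eq_sum, ← Finset.mul_sum, Strand.sum_cover, hρ,
    inv_mul_cancel_left₀ hcard.ne']

/-! ### The exact value of the strengthened relaxation -/

section Simplex

variable {d s : ℕ}

theorem exists_add_single_of_l1Dist_eq_one {v w : Fin (d + 1) → ℕ} (h : l1Dist v w = 1) :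
    ∃ g, w = v + Pi.single g 1 ∨ v = w + Pi.single g 1 := by
  have hnn : ∀ i ∈ Finset.univ, 0 ≤ |(v i : ℤ) - (w i : ℤ)| := fun _ _ => abs_nonneg _
  have h₀ : ∃ g, |(v g : ℤ) - (w g : ℤ)| ≠ 0 := by
    by_contra! h'
    rw [l1Dist, Finset.sum_eq_zero fun i _ => h' i] at h
    exact zero_ne_one h
  obtain ⟨g, hg⟩ := h₀
  have hg' := hnn g (Finset.mem_univ g)
  rw [l1Dist, ← Finset.add_sum_erase _ _ (Finset.mem_univ g)] at h
  have hrest := Finset.sum_nonneg fun i (hi : i ∈ Finset.univ.erase g) => hnn i (Finset.mem_univ i)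
  have h₁ : ∑ i ∈ Finset.univ.erase g, |(v i : ℤ) - (w i : ℤ)| = 0 := by omega
  rw [Finset.sum_eq_zero_iff_of_nonneg fun i _ => hnn i (Finset.mem_univ i)] at h₁
  have h₂ : ∀ i, i ≠ g → v i = w i := by
    intro i hi
    have := h₁ i (by simp [hi])
    rw [abs_eq_zero] at this
    omega
  have h₃ : |(v g : ℤ) - (w g : ℤ)| = 1 := by omega
  refine ⟨g, ?_⟩
  rcases (abs_eq one_pos.le).1 h₃ with h₄ | h₄
  · right
    ext i
    rcases eq_or_ne i g with rfl | hi
    · simp; omega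
    · simp [hi, h₂ i hi]
  · left
    ext i
    rcases eq_or_ne i g with rfl | hi
    · simp; omega
    · simp [hi, h₂ i hi]

/-- Every arc either raises one coordinate of a lower vertex or reverses such an arc. -/
theorem arc_cases (a : (simplexInstance d s).Arc) :
    (∃ g, a.snd.1 = a.fst.1 + Pi.single g 1 ∧ ∑ i, a.fst.1 i = s ∧ ∑ i, a.snd.1 i = s + 1) ∨
      ∃ g, a.fst.1 = a.snd.1 + Pi.single g 1 ∧ ∑ i, a.fst.1 i = s + 1 ∧ ∑ i, a.snd.1 i = s := by
  have h₁ := (mem_simplexVertices.1 a.fst.2).1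
  have h₂ := (mem_simplexVertices.1 a.snd.2).1
  have hadj : l1Dist a.fst.1 a.snd.1 = 1 := a.adj
  obtain ⟨g, hg | hg⟩ := exists_add_single_of_l1Dist_eq_one hadj
  · have h₃ : ∑ i, a.snd.1 i = ∑ i, a.fst.1 i + 1 := by
      rw [hg]
      simp only [Pi.add_apply, Finset.sum_add_distrib, sum_single_one]
    exact Or.inl ⟨g, hg, by omega, by omega⟩
  · have h₃ : ∑ i, a.fst.1 i = ∑ i, a.snd.1 i + 1 := by
      rw [hg]
      simp only [Pi.add_apply, Finset.sum_add_distrib, sum_single_one]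
    exact Or.inr ⟨g, hg, by omega, by omega⟩

theorem sum_corner (t : Fin (d + 1)) : ∑ i, (corner d s t).1 i = s := by
  simp [corner]

open Classical in
-- An arc raising coordinate `g` enters only the cut for `t = g` and `k = a.fst.1 g`; a downward arc
-- enters none.
theorem sum_level_le (r : Fin (d + 1)) (a : (simplexInstance d s).Arc) :
    ∑ t ∈ Finset.univ.erase r, ∑ k ∈ Finset.range s,
      (if ¬ k + 1 ≤ a.fst.1 t ∧ k + 1 ≤ a.snd.1 t then (1 : ℝ) else 0) ≤
      if ∑ i, a.snd.1 i = s + 1 then 1 else 0 := by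
  rcases arc_cases a with ⟨g, hg, -, hs⟩ | ⟨g, hg, -, hs⟩
  · rw [if_pos hs]
    calc _ ≤ ∑ t : Fin (d + 1), ∑ k ∈ Finset.range s,
          (if t = g then (if k = a.fst.1 g then (1 : ℝ) else 0) else 0) := by
          refine (Finset.sum_le_sum fun t _ => Finset.sum_le_sum fun k _ => ?_).trans
            (Finset.sum_le_sum_of_subset_of_nonneg (Finset.subset_univ _) fun t _ _ =>
              Finset.sum_nonneg fun k _ => by split_ifs <;> norm_num)
          rcases eq_or_ne t g with rfl | ht
          · rw [hg, Pi.add_apply, Pi.single_eq_same, if_pos rfl]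
            split_ifs with h₁ h₂ <;> first | omega | norm_num
          · rw [hg, Pi.add_apply, Pi.single_eq_of_ne ht, if_neg ht, if_neg (by omega)]
      _ = ∑ k ∈ Finset.range s, (if k = a.fst.1 g then (1 : ℝ) else 0) := by
          rw [Finset.sum_eq_single g]
          · simp
          · intro t _ ht
            simp [ht]
          · simp
      _ ≤ 1 := by
          rw [Finset.sum_ite_eq']
          split_ifs <;> norm_num
  · rw [if_neg (by omega)]
    refine (Finset.sum_eq_zero fun t _ => Finset.sum_eq_zero fun k _ => if_neg ?_).le
    rw [hg, Pi.add_apply]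
    omega

open Classical in
-- Sum the `s * d` cut constraints for the sets `v t ≥ k + 1` with `t ≠ r` and `k < s`.
theorem le_sum_up {r : Fin (d + 1)} {x : (simplexInstance d s).Arc → ℝ}
    (hx : (simplexInstance d s).IsBCRFeasible (corner d s r) x) :
    (s * d : ℝ) ≤ ∑ a, if ∑ i, a.snd.1 i = s + 1 then x a else 0 := by
  have h₁ : ∀ t ∈ Finset.univ.erase r, ∀ k ∈ Finset.range s,
      (1 : ℝ) ≤ ∑ a : (simplexInstance d s).Arc,
        x a * (if ¬ k + 1 ≤ a.fst.1 t ∧ k + 1 ≤ a.snd.1 t then (1 : ℝ) else 0) := by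
    intro t ht k hk
    have h := hx.cut {v : (simplexInstance d s).V | k + 1 ≤ v.1 t}
      (by
        change ¬ k + 1 ≤ (Pi.single r s : Fin (d + 1) → ℕ) t
        rw [Pi.single_eq_of_ne (Finset.ne_of_mem_erase ht)]
        exact Nat.not_succ_le_zero k) ⟨corner d s t, corner_mem_R d s t, by
        change k + 1 ≤ (Pi.single t s : Fin (d + 1) → ℕ) t
        rw [Pi.single_eq_same]
        exact Finset.mem_range.1 hk⟩
    refine h.trans_eq ?_
    unfold SteinerInstance.inflow
    rw [Finset.sum_filter]
    refine Finset.sum_congr rfl fun a _ => ?_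
    rw [mul_ite, mul_one, mul_zero]
    by_cases h' : ¬ k + 1 ≤ a.fst.1 t ∧ k + 1 ≤ a.snd.1 t
    · rw [if_pos h']
      exact if_pos h'
    · rw [if_neg h']
      exact if_neg h'
  calc (s * d : ℝ) = ∑ t ∈ Finset.univ.erase r, ∑ k ∈ Finset.range s, (1 : ℝ) := by
        simp [mul_comm]
    _ ≤ _ := Finset.sum_le_sum fun t ht => Finset.sum_le_sum fun k hk => h₁ t ht k hk
    _ = ∑ a : (simplexInstance d s).Arc, x a * ∑ t ∈ Finset.univ.erase r, ∑ k ∈ Finset.range s,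
          (if ¬ k + 1 ≤ a.fst.1 t ∧ k + 1 ≤ a.snd.1 t then (1 : ℝ) else 0) := by
        simp only [Finset.mul_sum]
        rw [Finset.sum_congr rfl fun t _ => Finset.sum_comm, Finset.sum_comm]
    _ ≤ _ := Finset.sum_le_sum fun a _ =>
        (mul_le_mul_of_nonneg_left (sum_level_le r a) (hx.nonneg a)).trans_eq (by simp)

open Classical in
-- Upward arcs are exactly those entering upper vertices, and downward arcs those leaving them. No
-- corner is an upper vertex, so the Steiner constraint holds at each of these and can be summed.
theorem sum_up_le_sum_down {r : (simplexInstance d s).V} {x : (simplexInstance d s).Arc → ℝ}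
    (hx : (simplexInstance d s).IsBCRPlusFeasible r x) :
    (∑ a, if ∑ i, a.snd.1 i = s + 1 then x a else 0) ≤
      ∑ a, if ∑ i, a.snd.1 i = s + 1 then 0 else x a := by
  have h₁ : ∑ v : (simplexInstance d s).V with ∑ i, v.1 i = s + 1,
      (simplexInstance d s).inflow x {v} =
      ∑ a, if ∑ i, a.snd.1 i = s + 1 then x a else 0 := by
    unfold SteinerInstance.inflow
    simp only [Finset.sum_filter]
    simp only [← Finset.sum_filter (fun v : (simplexInstance d s).V => ∑ i, v.1 i = s + 1)]
    rw [Finset.sum_comm]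
    refine Finset.sum_congr rfl fun a _ => ?_
    rw [Finset.sum_filter, Finset.sum_eq_single a.snd]
    · rw [if_pos (⟨a.adj.ne, rfl⟩ : a.fst ∉ ({a.snd} : Set _) ∧ a.snd ∈ ({a.snd} : Set _))]
    · intro v _ hv
      rw [if_neg fun h : a.fst ∉ ({v} : Set _) ∧ a.snd ∈ ({v} : Set _) => hv h.2.symm, ite_self]
    · simp
  have h₂ : ∑ v : (simplexInstance d s).V with ∑ i, v.1 i = s + 1,
      (simplexInstance d s).outflow x {v} =
      ∑ a, if ∑ i, a.snd.1 i = s + 1 then 0 else x a := by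
    unfold SteinerInstance.outflow
    simp only [Finset.sum_filter]
    simp only [← Finset.sum_filter (fun v : (simplexInstance d s).V => ∑ i, v.1 i = s + 1)]
    rw [Finset.sum_comm]
    refine Finset.sum_congr rfl fun a _ => ?_
    rw [Finset.sum_filter, Finset.sum_eq_single a.fst]
    · rw [if_pos (⟨rfl, a.adj.ne'⟩ : a.fst ∈ ({a.fst} : Set _) ∧ a.snd ∉ ({a.fst} : Set _))]
      rcases arc_cases a with ⟨g, -, h, h'⟩ | ⟨g, -, h, h'⟩
      · rw [if_pos h', if_neg (by omega)]
      · rw [if_pos h, if_neg (by omega : ¬ ∑ i, a.snd.1 i = s + 1)]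
    · intro v _ hv
      rw [if_neg fun h : a.fst ∈ ({v} : Set _) ∧ a.snd ∉ ({v} : Set _) => hv h.1.symm, ite_self]
    · simp
  rw [← h₁, ← h₂]
  refine Finset.sum_le_sum fun v hv => hx.steiner v fun hvR => ?_
  obtain ⟨t, rfl⟩ := mem_R_iff.1 hvR
  have h := (Finset.mem_filter.1 hv).2
  rw [sum_corner] at h
  omega

theorem le_cost_of_isBCRPlusFeasible {r : Fin (d + 1)} {x : (simplexInstance d s).Arc → ℝ}
    (hx : (simplexInstance d s).IsBCRPlusFeasible (corner d s r) x) :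
    (2 * s * d : ℝ) ≤ (simplexInstance d s).cost x := by
  classical
  have h₁ := le_sum_up hx.toIsBCRFeasible
  have h₂ := sum_up_le_sum_down hx
  have h₃ : (simplexInstance d s).cost x =
      (∑ a, if ∑ i, a.snd.1 i = s + 1 then x a else 0) +
        ∑ a, if ∑ i, a.snd.1 i = s + 1 then 0 else x a := by
    rw [cost_eq_sum, ← Finset.sum_add_distrib]
    refine Finset.sum_congr rfl fun a _ => ?_
    split_ifs <;> simp
  rw [h₃]
  linarith

/-- The straight track from the corner `r` to the corner `t`. -/
def straightTrack (s : ℕ) {r t : Fin (d + 1)} (h : t ≠ r) : Track d s t :=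
  Track.bend r r (fun _ => 0) (fun _ h => h) (fun _ _ => Or.inl rfl) (fun h' => absurd h'.symm h)
    fun _ _ _ => rfl

theorem straightTrack_vertex_zero {r t : Fin (d + 1)} (h : t ≠ r) :
    (straightTrack s h).vertex 0 (Nat.zero_le _) = corner d s r := by
  refine Subtype.ext ?_
  change (Pi.single t 0 + Pi.single r 0 + Pi.single r (s - 0 - 0) : Fin (d + 1) → ℕ) =
    Pi.single r s
  simp

/-- The straight tracks from the root to the other corners form a feasible solution. -/
theorem exists_isBCRPlusFeasible (d s : ℕ) (r : Fin (d + 1)) :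
    ∃ x, (simplexInstance d s).IsBCRPlusFeasible (corner d s r) x ∧
      (simplexInstance d s).cost x = 2 * s * d := by
  classical
  let f : {t : Fin (d + 1) // t ≠ r} → (simplexInstance d s).Arc → ℝ := fun t =>
    (straightTrack s t.2).flow 0
  have hf : ∀ t a, 0 ≤ f t a := fun t a => Track.flow_nonneg _ _ _
  have hnet : ∀ t U, (simplexInstance d s).inflow (f t) U - (simplexInstance d s).outflow (f t) U =
      (if corner d s t.1 ∈ U then 1 else 0) - (if corner d s r ∈ U then 1 else 0) := by
    intro t U
    rw [(straightTrack s t.2).flow_net (Nat.zero_le s) U, Track.vertex_last,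
      straightTrack_vertex_zero]
  -- The factor `1` gives the vector the form required by `inflow_const_mul_sum`.
  refine ⟨fun a => 1 * ∑ t, f t a, ⟨⟨fun a => ?_, ?_⟩, ?_⟩, ?_⟩
  · rw [one_mul]
    exact Finset.sum_nonneg fun t _ => hf t a
  · rintro U hr ⟨v, hv, hvU⟩
    obtain ⟨t, rfl⟩ := mem_R_iff.1 hv
    have ht : t ≠ r := fun h => hr (h ▸ hvU)
    have h₁ := hnet ⟨t, ht⟩ U
    rw [if_pos hvU, if_neg hr] at h₁
    have h₂ := (simplexInstance d s).outflow_nonneg (hf ⟨t, ht⟩) U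
    have h₃ := (simplexInstance d s).inflow_mono (x := f ⟨t, ht⟩) (y := fun a => 1 * ∑ t, f t a)
      (fun a => by
        rw [one_mul]
        exact Finset.single_le_sum (f := fun t => f t a) (fun t _ => hf t a) (Finset.mem_univ _)) U
    linarith
  · intro v hv
    rw [SteinerInstance.inflow_const_mul_sum, SteinerInstance.outflow_const_mul_sum]
    refine le_of_eq ?_
    rw [← sub_eq_zero, ← mul_sub, ← Finset.sum_sub_distrib, one_mul]
    refine Finset.sum_eq_zero fun t _ => ?_
    rw [hnet, if_neg fun h : corner d s t.1 ∈ ({v} : Set _) => hv (h ▸ corner_mem_R d s _),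
      if_neg fun h : corner d s r ∈ ({v} : Set _) => hv (h ▸ corner_mem_R d s _), sub_zero]
  · have h : ∀ t, ∑ a, f t a = 2 * s := by
      intro t
      have := (straightTrack s t.2).sum_flow_mul 0 fun _ => 1
      simp only [mul_one] at this
      rw [this]
      simp
      ring
    rw [cost_eq_sum, ← Finset.mul_sum, Finset.sum_comm, Finset.sum_congr rfl fun t _ => h t]
    simp
    ring

theorem optBCRPlus_simplexInstance (d s : ℕ) (r : Fin (d + 1)) :
    (simplexInstance d s).optBCRPlus (corner d s r) = 2 * s * d := by
  obtain ⟨x, hx, hc⟩ := exists_isBCRPlusFeasible d s r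
  refine IsLeast.csInf_eq ⟨⟨x, hx, hc⟩, ?_⟩
  rintro _ ⟨y, hy, rfl⟩
  exact le_cost_of_isBCRPlusFeasible hy

/-- Positivity of the denominator keeps the gap from being the default value of a division by zero.
-/
theorem one_le_optBCR (hd : 1 ≤ d) (hs : s ≠ 0) (r : Fin (d + 1)) :
    1 ≤ (simplexInstance d s).optBCR (corner d s r) := by
  classical
  obtain ⟨x₀, hx₀, -⟩ := exists_isBCRPlusFeasible d s r
  refine le_csInf ⟨_, x₀, hx₀.toIsBCRFeasible, rfl⟩ ?_
  rintro _ ⟨x, hx, rfl⟩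
  have : Nontrivial (Fin (d + 1)) := Fin.nontrivial_iff_two_le.2 (by omega)
  obtain ⟨t, ht⟩ := exists_ne r
  refine (hx.cut {corner d s t} (fun h => ht (corner_injective hs h).symm)
    ⟨_, corner_mem_R d s t, rfl⟩).trans ?_
  rw [cost_eq_sum]
  exact Finset.sum_le_sum_of_subset_of_nonneg (Finset.subset_univ _) fun a _ _ => hx.nonneg a

/-! ### Connectivity and validity of the simplex instance -/

theorem exists_adj_lower {v : (simplexInstance d s).V} {g : Fin (d + 1)}
    (hv : ∑ i, v.1 i = s + 1) (hg : v.1 g ≠ 0) :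
    ∃ w : (simplexInstance d s).V, (simplexInstance d s).G.Adj v w ∧ ∑ i, w.1 i = s ∧
      v.1 = w.1 + Pi.single g 1 := by
  have hw : v.1 - Pi.single g 1 + Pi.single g 1 = v.1 := by
    refine tsub_add_cancel_of_le fun i => ?_
    rcases eq_or_ne i g with rfl | hi
    · rw [Pi.single_eq_same]
      exact Nat.one_le_iff_ne_zero.2 hg
    · rw [Pi.single_eq_of_ne hi]
      exact Nat.zero_le _
  have hsum : ∑ i, (v.1 - Pi.single g 1 : Fin (d + 1) → ℕ) i = s := by
    have h := congrArg (fun w : Fin (d + 1) → ℕ => ∑ i, w i) hw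
    simp only [Pi.add_apply, Finset.sum_add_distrib, sum_single_one] at h
    exact Nat.add_right_cancel (h.trans hv)
  refine ⟨⟨v.1 - Pi.single g 1, mem_simplexVertices.2 ⟨Or.inl hsum, fun i =>
    (Finset.single_le_sum (fun _ _ => Nat.zero_le _) (Finset.mem_univ i)).trans hsum.le⟩⟩,
    ?_, hsum, hw.symm⟩
  change l1Dist v.1 (v.1 - Pi.single g 1) = 1
  have h := l1Dist_add_single (v.1 - Pi.single g 1) g
  rwa [hw, l1Dist_comm] at h

/-- Induction on a bound `m` for the deficit `s - v 0`: one unit is moved from some other coordinate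
to `0` through an upper vertex. -/
theorem reachable_corner_of_lower (m : ℕ) : ∀ v : (simplexInstance d s).V, ∑ i, v.1 i = s →
    s ≤ v.1 0 + m → (simplexInstance d s).G.Reachable v (corner d s 0) := by
  induction m with
  | zero =>
    intro v hv h
    rw [← Finset.add_sum_erase _ _ (Finset.mem_univ (0 : Fin (d + 1)))] at hv
    have h₀ : ∑ i ∈ Finset.univ.erase 0, v.1 i = 0 := by omega
    have h₁ : v.1 0 = s := by omega
    rw [Finset.sum_eq_zero_iff] at h₀
    have h₂ : v = corner d s 0 := by
      refine Subtype.ext (funext fun i => ?_)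
      change v.1 i = (Pi.single 0 s : Fin (d + 1) → ℕ) i
      rcases eq_or_ne i 0 with rfl | hi
      · rw [Pi.single_eq_same, h₁]
      · rw [Pi.single_eq_of_ne hi, h₀ i (by simp [hi])]
    rw [h₂]
  | succ m ih =>
    intro v hv h
    by_cases hm : s ≤ v.1 0 + m
    · exact ih v hv hm
    have hne : ∃ g, g ≠ 0 ∧ v.1 g ≠ 0 := by
      by_contra! h'
      rw [Finset.sum_eq_single 0 (fun g _ hg => h' g hg) (by simp)] at hv
      exact hm (hv.ge.trans (Nat.le_add_right _ _))
    obtain ⟨g, hg, hvg⟩ := hne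
    have hle := (mem_simplexVertices.1 v.2).2
    have hsum : ∑ i, (v.1 + Pi.single 0 1 : Fin (d + 1) → ℕ) i = s + 1 := by
      simp only [Pi.add_apply, Finset.sum_add_distrib, sum_single_one]
      rw [hv]
    let u : (simplexInstance d s).V := ⟨v.1 + Pi.single 0 1, mem_simplexVertices.2
      ⟨Or.inr hsum, fun i => by
        rcases eq_or_ne i 0 with rfl | hi
        · rw [Pi.add_apply, Pi.single_eq_same]
          omega
        · simpa [hi] using hle i⟩⟩
    obtain ⟨w, huw, hw, hw'⟩ := exists_adj_lower (v := u) (g := g) hsum (by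
      change v.1 g + (Pi.single 0 1 : Fin (d + 1) → ℕ) g ≠ 0
      omega)
    have hvu : (simplexInstance d s).G.Adj v u := l1Dist_add_single _ _
    refine (hvu.reachable.trans huw.reachable).trans (ih w hw ?_)
    have h₁ : v.1 0 + (Pi.single 0 1 : Fin (d + 1) → ℕ) 0 =
        w.1 0 + (Pi.single g 1 : Fin (d + 1) → ℕ) 0 := congrFun hw' 0
    rw [Pi.single_eq_same, Pi.single_eq_of_ne hg.symm] at h₁
    omega

theorem reachable_corner (v : (simplexInstance d s).V) :
    (simplexInstance d s).G.Reachable v (corner d s 0) := by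
  rcases (mem_simplexVertices.1 v.2).1 with h | h
  · exact reachable_corner_of_lower s v h (Nat.le_add_left _ _)
  · obtain ⟨g, -, hg⟩ := Finset.exists_ne_zero_of_sum_ne_zero (h.trans_ne (Nat.succ_ne_zero s))
    obtain ⟨w, hvw, hw, -⟩ := exists_adj_lower h hg
    exact hvw.reachable.trans (reachable_corner_of_lower s w hw (Nat.le_add_left _ _))

theorem isValid_simplexInstance (d s : ℕ) : (simplexInstance d s).IsValid where
  connected := by
    have : Nonempty (simplexInstance d s).V := ⟨corner d s 0⟩
    exact ⟨fun v w => (reachable_corner v).trans (reachable_corner w).symm⟩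
  nonempty := ⟨_, corner_mem_R d s 0⟩
  cost_nonneg := by
    intro e he
    induction e with
    | h v w =>
      have h : (simplexInstance d s).c s(v, w) = 1 := c_edge ⟨(v, w), he⟩
      rw [h]
      exact zero_le_one

theorem card_R_le (d s : ℕ) : (simplexInstance d s).R.card ≤ d + 1 := by
  classical
  have h : (simplexInstance d s).R ⊆ Finset.univ.image (corner d s) := fun v hv => by
    obtain ⟨t, rfl⟩ := mem_R_iff.1 hv
    exact Finset.mem_image_of_mem _ (Finset.mem_univ t)
  exact (Finset.card_le_card h).trans (Finset.card_image_le.trans (by simp))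

end Simplex

/-! ### The gap bound and its limit -/

theorem simplexInstance_bounds {d n : ℕ} (hd : 1 ≤ d) (hn : 1 ≤ n)
    {r : (simplexInstance d (3 * n + 1)).V} (hr : r ∈ (simplexInstance d (3 * n + 1)).R) :
    (simplexInstance d (3 * n + 1)).optBCR r ≤
        ((3 * n + 1 : ℕ) : ℝ) / 3 * (5 * d + 1 + ((d : ℝ) - 1) / (3 * n + 1 : ℕ)) ∧
      (simplexInstance d (3 * n + 1)).optBCRPlus r = 2 * (3 * n + 1 : ℕ) * d ∧
      6 * (d : ℝ) / (5 * d + 1 + ((d : ℝ) - 1) / (3 * n + 1 : ℕ)) ≤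
        (simplexInstance d (3 * n + 1)).gap r := by
  obtain ⟨t, rfl⟩ := mem_R_iff.1 hr
  have hle : (simplexInstance d (3 * n + 1)).optBCR (corner d (3 * n + 1) t) ≤
      ((3 * n + 1 : ℕ) : ℝ) / 3 * (5 * d + 1 + ((d : ℝ) - 1) / (3 * n + 1 : ℕ)) := by
    obtain ⟨x, hx, hc⟩ := exists_isBCRFeasible d n hd hn t
    refine ((optBCR_le_cost (isValid_simplexInstance d _) hx).trans_eq hc).trans_eq ?_
    -- With `n = (s - 1) / 3`, the cost `2 * s * d - (d - 1) * n` is the stated bound.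
    push_cast
    field_simp
    ring
  have hplus := optBCRPlus_simplexInstance d (3 * n + 1) t
  have hpos := one_le_optBCR hd (Nat.succ_ne_zero (3 * n)) t
  have hd' : (1 : ℝ) ≤ d := by exact_mod_cast hd
  have hs : (0 : ℝ) < (3 * n + 1 : ℕ) := by positivity
  have hden : (0 : ℝ) < 5 * d + 1 + ((d : ℝ) - 1) / (3 * n + 1 : ℕ) := by
    have := div_nonneg (sub_nonneg.2 hd') hs.le
    linarith
  refine ⟨hle, hplus, ?_⟩
  rw [SteinerInstance.gap, hplus, div_le_div_iff₀ hden (zero_lt_one.trans_le hpos)]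
  calc _ ≤ 6 * (d : ℝ) *
        (((3 * n + 1 : ℕ) : ℝ) / 3 * (5 * d + 1 + ((d : ℝ) - 1) / (3 * n + 1 : ℕ))) :=
        mul_le_mul_of_nonneg_left hle (by linarith)
    _ = _ := by ring

theorem tendsto_gap_bound (d : ℕ) :
    Filter.Tendsto
      (fun δ : ℕ => 6 * (d : ℝ) / (5 * d + 1 + ((d : ℝ) - 1) / (3 * δ - 2 : ℕ)))
      Filter.atTop (nhds (6 * (d : ℝ) / (5 * d + 1))) := by
  have h : Filter.Tendsto (fun δ : ℕ => 3 * δ - 2) Filter.atTop Filter.atTop :=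
    Filter.tendsto_atTop_mono' _
      ((Filter.eventually_ge_atTop 1).mono fun δ hδ => show δ ≤ 3 * δ - 2 by omega)
      Filter.tendsto_id
  have h' := (tendsto_const_div_atTop_nhds_zero_nat ((d : ℝ) - 1)).comp h
  refine tendsto_const_nhds.div ?_ (by positivity)
  simpa using h'.const_add (5 * (d : ℝ) + 1)

theorem gap_le_worstGap {I : SteinerInstance} {k : ℕ} (hI : I.IsValid) (hk : I.R.card ≤ k)
    {r : I.V} (hr : r ∈ I.R) : ((I.gap r : ℝ) : EReal) ≤ worstGap k :=
  le_iSup_of_le I <| le_iSup_of_le hI <| le_iSup_of_le hk <| le_iSup_of_le r <|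
    le_iSup_of_le hr le_rfl

theorem mainTheorem1 :
    (∀ d s : ℕ, 1 ≤ d → 2 ≤ s → (∃ δ : ℕ, s + 2 = 3 * δ) →
      ∀ r ∈ (simplexInstance d s).R,
        (simplexInstance d s).optBCR r ≤ (s : ℝ) / 3 * (5 * d + 1 + ((d : ℝ) - 1) / s) ∧
        (simplexInstance d s).optBCRPlus r = 2 * s * d ∧
        6 * (d : ℝ) / (5 * d + 1 + ((d : ℝ) - 1) / s) ≤ (simplexInstance d s).gap r) ∧
    (∀ d : ℕ, 1 ≤ d →
      (∀ r : (δ : ℕ) → (simplexInstance d (3 * δ - 2)).V,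
        (∀ δ, r δ ∈ (simplexInstance d (3 * δ - 2)).R) →
        ((6 * (d : ℝ) / (5 * d + 1) : ℝ) : EReal) ≤
          Filter.liminf (fun δ : ℕ => (((simplexInstance d (3 * δ - 2)).gap (r δ) : ℝ) : EReal))
            Filter.atTop) ∧
      ((6 * (d : ℝ) / (5 * d + 1) : ℝ) : EReal) ≤ worstGap (d + 1)) := by
  have hmain : ∀ d s : ℕ, 1 ≤ d → 2 ≤ s → (∃ δ : ℕ, s + 2 = 3 * δ) →
      ∀ r ∈ (simplexInstance d s).R,
        (simplexInstance d s).optBCR r ≤ (s : ℝ) / 3 * (5 * d + 1 + ((d : ℝ) - 1) / s) ∧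
        (simplexInstance d s).optBCRPlus r = 2 * s * d ∧
        6 * (d : ℝ) / (5 * d + 1 + ((d : ℝ) - 1) / s) ≤ (simplexInstance d s).gap r := by
    rintro d s hd hs ⟨δ, hδ⟩ r hr
    -- The hypothesis `2 ≤ s` excludes `n = 0`, where there are no strands.
    obtain ⟨n, hn, rfl⟩ : ∃ n, 1 ≤ n ∧ s = 3 * n + 1 := ⟨δ - 1, by omega, by omega⟩
    exact simplexInstance_bounds hd hn hr
  refine ⟨hmain, fun d hd => ⟨fun r hr => ?_, ?_⟩⟩
  · have ht := EReal.tendsto_coe.2 (tendsto_gap_bound d)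
    rw [← ht.liminf_eq]
    refine Filter.liminf_le_liminf ?_
    -- From `δ = 2` on, `3 * δ - 2` is a true subtraction with value at least `2`.
    filter_upwards [Filter.eventually_ge_atTop 2] with δ hδ
    exact EReal.coe_le_coe_iff.2
      (hmain d (3 * δ - 2) hd (by omega) ⟨δ, by omega⟩ (r δ) (hr δ)).2.2
  -- Every instance of the sequence has at most `d + 1` required vertices, so the supremum bounds
  -- each term and hence the limit.
  · refine le_of_tendsto (EReal.tendsto_coe.2 (tendsto_gap_bound d)) ?_
    filter_upwards [Filter.eventually_ge_atTop 2] with δ hδ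
    exact (EReal.coe_le_coe_iff.2 (hmain d (3 * δ - 2) hd (by omega) ⟨δ, by omega⟩ _
      (corner_mem_R d _ 0)).2.2).trans
      (gap_le_worstGap (isValid_simplexInstance d _) (card_R_le d _) (corner_mem_R d _ 0))
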